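/- Let $n\ge 3$, let $G=(V,E)$ be a simple undirected graph on the set of players $V=\{1,\dots,n\}$ (the \emph{key-sharing graph}), and let $D$ be a set of data items with $|D|\ge 2$. Consider a classical protocol $P$ among the players whose only resources are one uniformly random shared bit of key for each edge of $G$ (known to exactly the two endpoints), a private random string of each player taking finitely many values, all of these being independent, and broadcast/public communication. The protocol has finitely many rounds; in each round the players, one after another, publicly transmit one message each, which is a function of the round, the player, his role (sender of $d\in D$, receiver, or neither), his own randomness (the keys on his incident edges and his private string) and all earlier messages. Assume that $P$ transmits data: for all players $s\neq r$ and all $d\in D$, if $s$ is the sender of $d$ and $r$ the receiver, then with probability 1 the receiver can compute $d$ from his own randomness and the messages. For a set $A\subset V$ of $t\le n-2$ corrupted players, let the sender be uniform on $V\setminus A$ and the receiver uniform on the players other than the sender, independently of all keys and private strings; the adversary's view consists of all messages together with the randomness and the roles of the players in $A$. The protocol is \emph{sender anonymous} if for every such $A$, every $d\in D$ and every view of positive probability, the maximum, over all guesses $S$ that are functions of the view, of the conditional probability given the view that $S$ is the sender equals the a priori value $1/(n-t)$. The players in $A$ \emph{break the anonymity} of a player $j$ if for some $d\in D$ there is a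 view of positive probability given which $j$ is the sender with conditional probability larger than $1/(n-t)$. Then: (1) if $P$ is sender anonymous, every node of $G$ has degree at least $2$; (2) if $j\neq k$ are players such that $j$ has no neighbour in $G$ other than possibly $k$, then removing $k$ disconnects $G$ (the subgraph induced on $V\setminus\{k\}$ is not connected), and the single player $k$ breaks the anonymity of $j$. -/

import Mathlib

/-- The role of a player in one run. Only the sender holds the data item. -/
inductive Role (D : Type*) where
  | sender (d : D)
  | receiver
  | neither

universe uD uM uT

/-- A classical protocol among the players `0, …, n-1` whose only resources are one shared bit of
key for every edge of the key-sharing graph `G`, local private randomness, and broadcast / public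
communication. Player `m` has a private random string `Tape m`, with an arbitrary law, and in every
round the players, one after another, publicly transmit one message each. The message of player `m`
in round `i` is a function of `i`, `m`, his role (with the data item if he is the sender), his own
randomness (the key bits on his incident edges and his private random string) and all the messages
transmitted so far. -/
structure KeyProtocol (n : ℕ) (G : SimpleGraph (Fin n)) (D : Type uD) where
  rounds : ℕ
  Msg : Type uM
  Tape : Fin n → Type uT
  tapeFintype : ∀ m, Fintype (Tape m)
  tapeLaw : ∀ m, PMF (Tape m)
  message : Fin rounds → (m : Fin n) → Role D → (G.neighborSet m → Bool) × Tape m →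
    List Msg → Msg

namespace KeyProtocol

attribute [instance] KeyProtocol.tapeFintype

variable {n : ℕ} {G : SimpleGraph (Fin n)} {D : Type uD}

/-- The key bits on all edges together with the private random strings of all players. -/
abbrev Randomness (P : KeyProtocol.{uD, uM, uT} n G D) : Type uT :=
  (G.edgeSet → Bool) × ((m : Fin n) → P.Tape m)

/-- The randomness held by one player: the keys on his incident edges and his private string. -/
abbrev Local (P : KeyProtocol.{uD, uM, uT} n G D) (m : Fin n) : Type uT :=
  (G.neighborSet m → Bool) × P.Tape m

/-- The part of the randomness that player `m` holds. -/
def localPart (P : KeyProtocol.{uD, uM, uT} n G D) (ω : P.Randomness) (m : Fin n) : P.Local m :=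
  (fun i => ω.1 ⟨s(m, (i : Fin n)), i.2⟩, ω.2 m)

/-- Keys are uniform bits; all keys and all private random strings are independent. -/
noncomputable def randProb [DecidableRel G.Adj] (P : KeyProtocol.{uD, uM, uT} n G D)
    (ω : P.Randomness) : ℝ :=
  (1 / 2) ^ Fintype.card G.edgeSet * ∏ m, (P.tapeLaw m (ω.2 m)).toReal

/-- The roles when `s` sends the data item `d` and `r` is the receiver. -/
def roles (s r : Fin n) (d : D) (m : Fin n) : Role D :=
  if m = s then .sender d else if m = r then .receiver else .neither

/-- The sequence of all messages in a run: the turns are ordered by round, then by player. -/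
def transcript (P : KeyProtocol.{uD, uM, uT} n G D) (role : Fin n → Role D) (ω : P.Randomness) :
    List P.Msg :=
  (List.finRange P.rounds ×ˢ List.finRange n).foldl
    (fun hist turn =>
      hist ++ [P.message turn.1 turn.2 (role turn.2) (P.localPart ω turn.2) hist]) []

/-- The protocol transmits data: whoever is the sender `s`, whoever else is the receiver `r`, and
whatever the data item `d`, at the end the receiver knows `d`, that is, computes it from his own
randomness and the messages. -/
def Transmits [DecidableRel G.Adj] (P : KeyProtocol.{uD, uM, uT} n G D) : Prop :=
  ∃ decode : (r : Fin n) → P.Local r → List P.Msg → D,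
    ∀ (s r : Fin n) (d : D) (ω : P.Randomness), s ≠ r → 0 < P.randProb ω →
      decode r (P.localPart ω r) (P.transcript (roles s r d) ω) = d

/-- An outcome of the experiment: sender, receiver, and all the randomness. -/
structure Outcome (P : KeyProtocol.{uD, uM, uT} n G D) where
  sender : Fin n
  receiver : Fin n
  rand : P.Randomness

open Classical in
/-- The probability of an event `A` when the players in `E` are corrupted: the sender is uniform
on the `n - |E|` players outside `E`, the receiver is uniform on the `n - 1` players other than the
sender, and the randomness is independent of both. -/
noncomputable def prob [DecidableRel G.Adj] (P : KeyProtocol.{uD, uM, uT} n G D)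
    (E : Finset (Fin n)) (A : P.Outcome → Prop) : ℝ :=
  ∑ s ∈ Finset.univ \ E, ∑ r ∈ Finset.univ.erase s, ∑ ω : P.Randomness,
    if A ⟨s, r, ω⟩ then 1 / ((n : ℝ) - E.card) * (1 / ((n : ℝ) - 1)) * P.randProb ω else 0

/-- What an adversary corrupting `E` sees: all messages, and the randomness and the roles of the
corrupted players. -/
abbrev View (P : KeyProtocol.{uD, uM, uT} n G D) (E : Finset (Fin n)) :=
  List P.Msg × ((m : E) → P.Local m × Role D)

/-- The adversary's view of an outcome in which the data item `d` is sent. -/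
def view (P : KeyProtocol.{uD, uM, uT} n G D) (E : Finset (Fin n)) (d : D) (o : P.Outcome) :
    P.View E :=
  (P.transcript (roles o.sender o.receiver d) o.rand,
    fun m => (P.localPart o.rand m, roles o.sender o.receiver d m))

/-- `Pr[A | view = w]`. -/
noncomputable def condProb [DecidableRel G.Adj] (P : KeyProtocol.{uD, uM, uT} n G D)
    (E : Finset (Fin n)) (d : D) (w : P.View E) (A : P.Outcome → Prop) : ℝ :=
  P.prob E (fun o => A o ∧ P.view E d o = w) / P.prob E (fun o => P.view E d o = w)

/-- The sender stays anonymous against the corruption of `E`: whatever the data item, and for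
every view `w` that occurs, the maximum of `Pr[S = sender | view = w]` over all guesses `S` that
depend only on the view is the a priori value `1 / (n - |E|)`. -/
def AnonymousAgainst [DecidableRel G.Adj] (P : KeyProtocol.{uD, uM, uT} n G D)
    (E : Finset (Fin n)) : Prop :=
  ∀ (d : D) (w : P.View E), 0 < P.prob E (fun o => P.view E d o = w) →
    IsGreatest
      (Set.range fun S : P.View E → Fin n =>
        P.condProb E d w (fun o => S (P.view E d o) = o.sender))
      (1 / ((n : ℝ) - E.card))

/-- Sender anonymity: anonymity against every adversary who corrupts at most `n - 2` players. -/
def SenderAnonymous [DecidableRel G.Adj] (P : KeyProtocol.{uD, uM, uT} n G D) : Prop :=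
  ∀ E : Finset (Fin n), E.card + 2 ≤ n → P.AnonymousAgainst E

/-- The players in `E` break the anonymity of `j`: for some data item, a view occurs given which
`j` is the sender with probability larger than the a priori value `1 / (n - |E|)`. -/
def BreaksAnonymityOf [DecidableRel G.Adj] (P : KeyProtocol.{uD, uM, uT} n G D)
    (E : Finset (Fin n)) (j : Fin n) : Prop :=
  ∃ (d : D) (w : P.View E), 0 < P.prob E (fun o => P.view E d o = w) ∧
    1 / ((n : ℝ) - E.card) < P.condProb E d w (fun o => o.sender = j)

end KeyProtocol

/-! Suppose the only possible neighbour of `j` is `k`. Given what `k` observes, the private string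
of `j` is independent of the other players' randomness, so two runs that look alike to `k` can
exchange the part of `j` (`obsProb_mul_obsProb`). Let `k` receive, and for a view `w` write `M`,
`S_s`, `Y`, `X_s` for its likelihoods when `j` alone sends `d`, `s` alone sends, nobody sends, both
`j` and `s` send. The exchange gives `M * S_s = X_s * Y`.

If `k` does not break the anonymity of `j`, then `(n-2) M ≤ ∑ S_s` (`obsProb_le_sum`), hence `(n-2)
M² ≤ (∑ X_s) Y` and, by AM-GM, `2(n-2) M ≤ ∑ X_s + (n-2) Y`. Summed over views, both sides have the
same total, so equality holds at each view. Thus a view that occurs when nobody sends also occurs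
when `j` sends `d`, and `k` decodes `d` from it. As this holds for every `d`, two distinct data
items give a contradiction. -/

namespace List

/-- If two histories, built by successively appending messages, coincide, then every mixture of
the two rules builds the same history. -/
theorem foldl_append_mix {α β : Type*} {f f' g : α → List β → β} :
    ∀ {L : List α}, (∀ t, g t = f t ∨ g t = f' t) →
      ∀ {T : List β}, L.foldl (fun h t => h ++ [f t h]) [] = T →
        L.foldl (fun h t => h ++ [f' t h]) [] = T →
        L.foldl (fun h t => h ++ [g t h]) [] = T := by
  intro L hg
  induction L using List.reverseRecOn with
  | nil => intro T h _; simpa using h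
  | append_singleton L t ih =>
    intro T h h'
    simp only [List.foldl_append, List.foldl_cons, List.foldl_nil] at h h' ⊢
    -- Equal histories have equal prefixes and equal last messages.
    obtain ⟨h1, h2⟩ := List.append_inj' (h.trans h'.symm) rfl
    have h3 := ih rfl h1.symm
    rw [h3, ← h]
    rcases hg t with e | e
    · rw [e]
    · rw [e, h2, h1]

end List

/-! ### Exchanging the role and private string of one player. -/

namespace KeyProtocol

variable {n : ℕ} {G : SimpleGraph (Fin n)} {D : Type uD}

/-- What the corrupted players `E` observe under an arbitrary assignment of roles. -/
def observation (P : KeyProtocol.{uD, uM, uT} n G D) (E : Finset (Fin n)) (ρ : Fin n → Role D)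
    (ω : P.Randomness) : P.View E :=
  (P.transcript ρ ω, fun m => (P.localPart ω m, ρ m))

open Classical in
/-- The probability that the players in `E` observe `w` under the assignment `ρ` of roles. -/
noncomputable def obsProb [DecidableRel G.Adj] (P : KeyProtocol.{uD, uM, uT} n G D)
    (E : Finset (Fin n)) (ρ : Fin n → Role D) (w : P.View E) : ℝ :=
  ∑ ω : P.Randomness, if P.observation E ρ ω = w then P.randProb ω else 0

/-- Replace the private string of `j` in `ω` by the one in `ω'`. -/
def swapTape (P : KeyProtocol.{uD, uM, uT} n G D) (j : Fin n) (ω ω' : P.Randomness) :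
    P.Randomness :=
  (ω.1, Function.update ω.2 j (ω'.2 j))

section

variable (P : KeyProtocol.{uD, uM, uT} n G D)

theorem transcript_mix {ρ ρ' σ : Fin n → Role D} {ω ω' τ : P.Randomness} {T : List P.Msg}
    (h : ∀ m, (σ m = ρ m ∧ P.localPart τ m = P.localPart ω m) ∨
      (σ m = ρ' m ∧ P.localPart τ m = P.localPart ω' m))
    (hT : P.transcript ρ ω = T) (hT' : P.transcript ρ' ω' = T) : P.transcript σ τ = T := by
  refine List.foldl_append_mix
    (f := fun (t : Fin P.rounds × Fin n) h => P.message t.1 t.2 (ρ t.2) (P.localPart ω t.2) h)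
    (f' := fun (t : Fin P.rounds × Fin n) h => P.message t.1 t.2 (ρ' t.2) (P.localPart ω' t.2) h)
    (g := fun (t : Fin P.rounds × Fin n) h => P.message t.1 t.2 (σ t.2) (P.localPart τ t.2) h)
    ?_ hT hT'
  rintro ⟨i, m⟩
  rcases h m with ⟨h1, h2⟩ | ⟨h1, h2⟩
  · left; simp only [h1, h2]
  · right; simp only [h1, h2]

theorem localPart_swapTape_of_ne {j m : Fin n} (hm : m ≠ j) (ω ω' : P.Randomness) :
    P.localPart (P.swapTape j ω ω') m = P.localPart ω m := by
  simp [localPart, swapTape, hm]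

/-- Every key of `j` is also held by `k`, whose randomness is the same in both runs; only the
private string of `j` can differ. -/
theorem localPart_swapTape_self {j k : Fin n} (hN : G.neighborSet j ⊆ {k})
    {ω ω' : P.Randomness} (h : P.localPart ω k = P.localPart ω' k) :
    P.localPart (P.swapTape j ω ω') j = P.localPart ω' j := by
  refine Prod.ext ?_ (by simp [localPart, swapTape])
  funext i
  obtain ⟨i, hi⟩ := i
  obtain rfl : i = k := hN hi
  have h1 := congrFun (congrArg Prod.fst h) ⟨j, G.adj_symm hi⟩
  simp only [localPart, swapTape] at h1 ⊢
  have e : (⟨s(j, i), hi⟩ : G.edgeSet) = ⟨s(i, j), G.adj_symm hi⟩ := Subtype.ext Sym2.eq_swap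
  rw [e]
  exact h1

theorem observation_swapTape {j k : Fin n} (hjk : j ≠ k) (hN : G.neighborSet j ⊆ {k})
    {ρ ρ' : Fin n → Role D} {ω ω' : P.Randomness} {w : P.View {k}}
    (h : P.observation {k} ρ ω = w) (h' : P.observation {k} ρ' ω' = w) :
    P.observation {k} (Function.update ρ j (ρ' j)) (P.swapTape j ω ω') = w := by
  have hk : P.localPart ω k = P.localPart ω' k := by
    have := congrFun (congrArg Prod.snd (h.trans h'.symm)) ⟨k, Finset.mem_singleton_self k⟩
    exact congrArg Prod.fst this
  refine Prod.ext ?_ ?_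
  · refine P.transcript_mix (ρ := ρ) (ρ' := ρ') (ω := ω) (ω' := ω') (fun m => ?_)
      (congrArg Prod.fst h) (congrArg Prod.fst h')
    by_cases hm : m = j
    · subst hm
      exact Or.inr ⟨by simp, P.localPart_swapTape_self hN hk⟩
    · exact Or.inl ⟨by simp [hm], P.localPart_swapTape_of_ne hm ω ω'⟩
  · rw [← h]
    funext m
    have hm : (m : Fin n) ≠ j := by
      have := Finset.mem_singleton.1 m.2
      rw [this]; exact hjk.symm
    simp only [observation]
    rw [P.localPart_swapTape_of_ne hm, Function.update_of_ne hm]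

theorem swapTape_swapTape (j : Fin n) (ω ω' : P.Randomness) :
    P.swapTape j (P.swapTape j ω ω') (P.swapTape j ω' ω) = ω := by
  simp [swapTape]

/-! ### Likelihoods of observations. -/

variable [DecidableRel G.Adj]

theorem randProb_nonneg (ω : P.Randomness) : 0 ≤ P.randProb ω := by
  unfold randProb; positivity

theorem exists_randProb_pos : ∃ ω : P.Randomness, 0 < P.randProb ω := by
  choose t ht using fun m => (P.tapeLaw m).support_nonempty
  refine ⟨(fun _ => false, t), mul_pos (by positivity) (Finset.prod_pos fun m _ => ?_)⟩
  exact ENNReal.toReal_pos ((PMF.mem_support_iff _ _).1 (ht m)) (PMF.apply_ne_top _ _)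

/-- The law is a product, so exchanging one coordinate between two samples only permutes factors. -/
theorem randProb_swapTape (j : Fin n) (ω ω' : P.Randomness) :
    P.randProb (P.swapTape j ω ω') * P.randProb (P.swapTape j ω' ω) =
      P.randProb ω * P.randProb ω' := by
  simp only [randProb]
  rw [mul_mul_mul_comm, mul_mul_mul_comm _ _ ((1 / 2 : ℝ) ^ _), ← Finset.prod_mul_distrib,
    ← Finset.prod_mul_distrib]
  congr 1
  refine Finset.prod_congr rfl fun m _ => ?_
  by_cases hm : m = j
  · subst hm; simp [swapTape, mul_comm]
  · simp [swapTape, hm]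

theorem obsProb_nonneg (E : Finset (Fin n)) (ρ : Fin n → Role D) (w : P.View E) :
    0 ≤ P.obsProb E ρ w :=
  Finset.sum_nonneg fun ω _ => by split_ifs <;> simp [P.randProb_nonneg ω]

theorem obsProb_observation_pos (E : Finset (Fin n)) (ρ : Fin n → Role D) {ω : P.Randomness}
    (h : 0 < P.randProb ω) : 0 < P.obsProb E ρ (P.observation E ρ ω) := by
  refine Finset.sum_pos' (fun ω _ => ?_) ⟨ω, Finset.mem_univ _, by simpa using h⟩
  split_ifs <;> simp [P.randProb_nonneg ω]

theorem exists_of_obsProb_pos {E : Finset (Fin n)} {ρ : Fin n → Role D} {w : P.View E}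
    (h : 0 < P.obsProb E ρ w) : ∃ ω, P.observation E ρ ω = w ∧ 0 < P.randProb ω := by
  obtain ⟨ω, -, hω⟩ := Finset.exists_ne_zero_of_sum_ne_zero h.ne'
  split_ifs at hω with h1
  · exact ⟨ω, h1, lt_of_le_of_ne (P.randProb_nonneg ω) (Ne.symm hω)⟩
  · exact absurd rfl hω

theorem sum_obsProb {E : Finset (Fin n)} {ρ : Fin n → Role D} {W : Finset (P.View E)}
    (hW : ∀ ω, P.observation E ρ ω ∈ W) :
    ∑ w ∈ W, P.obsProb E ρ w = ∑ ω : P.Randomness, P.randProb ω := by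
  classical
  unfold obsProb
  rw [Finset.sum_comm]
  refine Finset.sum_congr (by congr!) fun ω _ => ?_
  rw [Finset.sum_ite_eq, if_pos (hW ω)]

/-- If `j` shares keys with `k` at most, then given the observation of `k` the randomness of `j` is
independent of that of the others, so that the roles of `j` can be exchanged. -/
theorem obsProb_mul_obsProb {j k : Fin n} (hjk : j ≠ k) (hN : G.neighborSet j ⊆ {k})
    (ρ ρ' : Fin n → Role D) (w : P.View {k}) :
    P.obsProb {k} ρ w * P.obsProb {k} ρ' w =
      P.obsProb {k} (Function.update ρ j (ρ' j)) w *
        P.obsProb {k} (Function.update ρ' j (ρ j)) w := by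
  classical
  simp only [obsProb, Finset.sum_mul_sum, ← Finset.sum_product']
  -- The exchange is an involution on pairs of samples that preserves the product weight.
  refine Finset.sum_nbij' (fun p => (P.swapTape j p.1 p.2, P.swapTape j p.2 p.1))
    (fun p => (P.swapTape j p.1 p.2, P.swapTape j p.2 p.1)) (by simp) (by simp)
    (fun p _ => by simp [swapTape_swapTape]) (fun p _ => by simp [swapTape_swapTape]) ?_
  rintro ⟨ω, ω'⟩ -
  have key : (P.observation {k} (Function.update ρ j (ρ' j)) (P.swapTape j ω ω') = w ∧
      P.observation {k} (Function.update ρ' j (ρ j)) (P.swapTape j ω' ω) = w) ↔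
      (P.observation {k} ρ ω = w ∧ P.observation {k} ρ' ω' = w) := by
    constructor
    · rintro ⟨h, h'⟩
      have a := P.observation_swapTape hjk hN h h'
      have b := P.observation_swapTape hjk hN h' h
      simp only [swapTape_swapTape, Function.update_self, Function.update_idem,
        Function.update_eq_self] at a b
      exact ⟨a, b⟩
    · rintro ⟨h, h'⟩
      exact ⟨P.observation_swapTape hjk hN h h', P.observation_swapTape hjk hN h' h⟩
  simp only [ite_zero_mul_ite_zero, key, randProb_swapTape]

/-- The event that `k`, who alone is corrupted, is the receiver and observes `w`. -/
theorem prob_view_eq {k : Fin n} (d : D) (A : Fin n → Prop) [DecidablePred A] {w : P.View {k}}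
    (hw : (w.2 ⟨k, Finset.mem_singleton_self k⟩).2 = .receiver) :
    P.prob {k} (fun o => A o.sender ∧ P.view {k} d o = w) =
      1 / ((n : ℝ) - 1) * (1 / ((n : ℝ) - 1)) *
        ∑ s ∈ Finset.univ.erase k, if A s then P.obsProb {k} (roles s k d) w else 0 := by
  classical
  unfold prob
  rw [Finset.mul_sum, Finset.sdiff_singleton_eq_erase]
  refine Finset.sum_congr (by congr!) fun s hs => ?_
  have hsk : s ≠ k := (Finset.mem_erase.1 hs).1
  rw [Finset.sum_eq_single k]
  · by_cases hA : A s
    · simp only [hA, true_and, if_true, obsProb, Finset.mul_sum, mul_ite, mul_zero,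
        Finset.card_singleton, Nat.cast_one]
      rfl
    · simp [hA]
  -- A receiver other than `k` contradicts the role that `k` sees in `w`.
  · intro r _ hr
    refine Finset.sum_eq_zero fun ω _ => if_neg ?_
    rintro ⟨-, h⟩
    rw [← h] at hw
    simp [view, roles, hsk.symm, hr.symm] at hw
  · intro h
    exact absurd (Finset.mem_erase.2 ⟨hsk.symm, Finset.mem_univ k⟩) h

/-- If `k` does not break the anonymity of `j`, then, when `k` is the receiver, no observation is
likelier with sender `j` than on average over the other senders. -/
theorem obsProb_le_sum (hn : 3 ≤ n) {j k : Fin n} (hjk : j ≠ k)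
    (hB : ¬ P.BreaksAnonymityOf {k} j) (d : D) {w : P.View {k}}
    (hw : (w.2 ⟨k, Finset.mem_singleton_self k⟩).2 = .receiver) :
    ((n : ℝ) - 2) * P.obsProb {k} (roles j k d) w ≤
      ∑ s ∈ (Finset.univ.erase k).erase j, P.obsProb {k} (roles s k d) w := by
  classical
  have hn' : (3 : ℝ) ≤ n := by exact_mod_cast hn
  have hj : j ∈ Finset.univ.erase k := Finset.mem_erase.2 ⟨hjk, Finset.mem_univ j⟩
  have hsum := Finset.add_sum_erase _ (fun s => P.obsProb {k} (roles s k d) w) hj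
  have hrest : 0 ≤ ∑ s ∈ (Finset.univ.erase k).erase j, P.obsProb {k} (roles s k d) w :=
    Finset.sum_nonneg fun s _ => P.obsProb_nonneg _ _ _
  rcases (P.obsProb_nonneg {k} (roles j k d) w).eq_or_lt with h0 | hpos
  · rw [← h0, mul_zero]; exact hrest
  have e1 := P.prob_view_eq d (fun _ => True) hw
  have e2 := P.prob_view_eq d (fun s => s = j) hw
  simp only [true_and, if_true] at e1
  rw [Finset.sum_ite_eq' _ j, if_pos hj] at e2
  have hc : (0 : ℝ) < 1 / ((n : ℝ) - 1) * (1 / ((n : ℝ) - 1)) := by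
    have : (0 : ℝ) < (n : ℝ) - 1 := by linarith
    positivity
  have htot : 0 < ∑ s ∈ Finset.univ.erase k, P.obsProb {k} (roles s k d) w := by
    rw [← hsum]; linarith
  have hle : P.condProb {k} d w (fun o => o.sender = j) ≤ 1 / ((n : ℝ) - 1) := by
    by_contra! hlt
    refine hB ⟨d, w, ?_, by simpa using hlt⟩
    rw [e1]; positivity
  -- The bound reads `M / (M + S) ≤ 1 / (n - 1)`, that is, `(n - 2) M ≤ S`.
  rw [condProb, e1, e2, mul_div_mul_left _ _ hc.ne', div_le_div_iff₀ htot (by linarith),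
    ← hsum] at hle
  linarith

theorem breaksAnonymityOf_of_neighborSet_subset (hn : 3 ≤ n) [Nontrivial D] (hP : P.Transmits)
    {j k : Fin n} (hjk : j ≠ k) (hN : G.neighborSet j ⊆ {k}) : P.BreaksAnonymityOf {k} j := by
  classical
  by_contra hB
  obtain ⟨decode, hdec⟩ := hP
  have hn' : (3 : ℝ) ≤ n := by exact_mod_cast hn
  set R : Finset (Fin n) := (Finset.univ.erase k).erase j with hR
  have hcard : (R.card : ℝ) = (n : ℝ) - 2 := by
    rw [hR, Finset.card_erase_of_mem (Finset.mem_erase.2 ⟨hjk, Finset.mem_univ j⟩),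
      Finset.card_erase_of_mem (Finset.mem_univ k), Finset.card_univ, Fintype.card_fin,
      Nat.sub_sub, Nat.cast_sub (by lia)]
    norm_num
  -- nobody sends, and `k` receives
  let idle : Fin n → Role D := fun m => if m = k then .receiver else .neither
  -- both `s` and `j` send
  let both : D → Fin n → Fin n → Role D := fun d s => Function.update (roles s k d) j (.sender d)
  obtain ⟨ω₀, hω₀⟩ := P.exists_randProb_pos
  have main (d : D) : decode k (P.localPart ω₀ k) (P.transcript idle ω₀) = d := by
    let 𝓡 : Finset (Fin n → Role D) :=
      insert idle (insert (roles j k d) (R.image (both d)))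
    -- `Msg` may be infinite, so sums run over the finitely many views attained under the role
    -- assignments entering `M`, `X` and `Y`.
    let W : Finset (P.View {k}) :=
      𝓡.biUnion fun ρ => Finset.univ.image (P.observation {k} ρ)
    have hmem {ρ} (hρ : ρ ∈ 𝓡) (ω : P.Randomness) : P.observation {k} ρ ω ∈ W :=
      Finset.mem_biUnion.2 ⟨ρ, hρ, Finset.mem_image_of_mem _ (Finset.mem_univ ω)⟩
    have hidle : idle ∈ 𝓡 := by simp [𝓡]
    have hone : roles j k d ∈ 𝓡 := by simp [𝓡]
    have hboth {s} (hs : s ∈ R) : both d s ∈ 𝓡 := by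
      simp only [𝓡, Finset.mem_insert, Finset.mem_image]
      exact Or.inr (Or.inr ⟨s, hs, rfl⟩)
    have hrecv {ρ} (hρ : ρ ∈ 𝓡) : ρ k = .receiver := by
      simp only [𝓡, Finset.mem_insert, Finset.mem_image] at hρ
      rcases hρ with rfl | rfl | ⟨s, hs, rfl⟩
      · simp [idle]
      · simp [roles, hjk.symm]
      · have : k ≠ s := fun h => by simp [hR, ← h] at hs
        simp [both, roles, hjk.symm, this]
    have hW {w} (hw : w ∈ W) : (w.2 ⟨k, Finset.mem_singleton_self k⟩).2 = .receiver := by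
      obtain ⟨ρ, hρ, hw⟩ := Finset.mem_biUnion.1 hw
      obtain ⟨ω, -, rfl⟩ := Finset.mem_image.1 hw
      exact hrecv hρ
    let X : P.View {k} → ℝ := fun w => ∑ s ∈ R, P.obsProb {k} (both d s) w
    let Y : P.View {k} → ℝ := fun w => P.obsProb {k} idle w
    let M : P.View {k} → ℝ := fun w => P.obsProb {k} (roles j k d) w
    let S : P.View {k} → ℝ := fun w => ∑ s ∈ R, P.obsProb {k} (roles s k d) w
    have hMS (w) : M w * S w = X w * Y w := by
      simp only [M, S, X, Y, Finset.mul_sum, Finset.sum_mul]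
      refine Finset.sum_congr rfl fun s hs => ?_
      have hsj : s ≠ j := (Finset.mem_erase.1 hs).1
      rw [P.obsProb_mul_obsProb hjk hN, mul_comm]
      congr 2
      · simp [both, roles]
      · funext m
        by_cases hm : m = j
        · subst hm; simp [roles, idle, hsj.symm, hjk]
        · simp [roles, idle, hm]
    have hle {w} (hw : w ∈ W) : ((n : ℝ) - 2) * M w ≤ S w := P.obsProb_le_sum hn hjk hB d (hW hw)
    have hM (w) : 0 ≤ M w := P.obsProb_nonneg _ _ _
    have hX (w) : 0 ≤ X w := Finset.sum_nonneg fun s _ => P.obsProb_nonneg _ _ _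
    have hY (w) : 0 ≤ Y w := P.obsProb_nonneg _ _ _
    have hMM {w} (hw : w ∈ W) : ((n : ℝ) - 2) * M w ^ 2 ≤ X w * Y w := by
      rw [← hMS]
      nlinarith [mul_le_mul_of_nonneg_left (hle hw) (hM w)]
    have hamgm : ∀ w ∈ W, 2 * ((n : ℝ) - 2) * M w ≤ X w + ((n : ℝ) - 2) * Y w := by
      intro w hw
      have h2 : (0 : ℝ) ≤ (n : ℝ) - 2 := by linarith
      refine abs_le_of_sq_le_sq' ?_ (by have := hX w; have := hY w; positivity) |>.2
      -- AM-GM for `X` and `(n - 2) Y`, in squared form.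
      nlinarith [mul_le_mul_of_nonneg_left (hMM hw) h2, sq_nonneg (X w - ((n : ℝ) - 2) * Y w)]
    have htotal : ∑ w ∈ W, 2 * ((n : ℝ) - 2) * M w = ∑ w ∈ W, (X w + ((n : ℝ) - 2) * Y w) := by
      simp only [M, X, Y]
      rw [Finset.sum_add_distrib, ← Finset.mul_sum, ← Finset.mul_sum, Finset.sum_comm,
        Finset.sum_congr rfl fun s hs => P.sum_obsProb (hmem (hboth hs)),
        P.sum_obsProb (hmem hone), P.sum_obsProb (hmem hidle), Finset.sum_const, nsmul_eq_mul,
        hcard]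
      ring
    set w₀ := P.observation {k} idle ω₀ with hw₀
    have hw₀W : w₀ ∈ W := hmem hidle ω₀
    -- A termwise inequality with equal sums is an equality in each term; then `Y w₀ > 0` forces `M
    -- w₀ > 0`.
    have heq := (Finset.sum_eq_sum_iff_of_le hamgm).1 htotal w₀ hw₀W
    have hYpos : 0 < Y w₀ := P.obsProb_observation_pos _ _ hω₀
    have hMpos : 0 < M w₀ := by
      refine lt_of_le_of_ne (hM w₀) fun h => ?_
      rw [← h] at heq
      have := mul_pos (show (0 : ℝ) < (n : ℝ) - 2 by linarith) hYpos
      linarith [hX w₀]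
    obtain ⟨ω, hω, hωpos⟩ := P.exists_of_obsProb_pos hMpos
    have h1 := hdec j k d ω hjk hωpos
    have h2 := congrArg Prod.fst hω
    have h3 := congrArg Prod.fst
      (congrFun (congrArg Prod.snd hω) ⟨k, Finset.mem_singleton_self k⟩)
    simp only [hw₀, observation] at h2 h3
    rw [← h2, ← h3, h1]
  obtain ⟨d, d', hd⟩ := exists_pair_ne D
  exact hd ((main d).symm.trans (main d'))

theorem not_breaksAnonymityOf_of_anonymousAgainst {E : Finset (Fin n)}
    (h : P.AnonymousAgainst E) (j : Fin n) : ¬ P.BreaksAnonymityOf E j := by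
  rintro ⟨d, w, hw, hlt⟩
  -- Always guessing `j` is an admissible guess.
  refine absurd ((h d w hw).2 ⟨fun _ => j, rfl⟩) (not_le.2 ?_)
  simpa only [eq_comm] using hlt

end

end KeyProtocol

/-! ### Connectivity and conclusion. -/

theorem SimpleGraph.not_preconnected_induce_compl_singleton {V : Type*} {G : SimpleGraph V}
    {j k l : V} (hjk : j ≠ k) (hlk : l ≠ k) (hlj : l ≠ j) (hN : G.neighborSet j ⊆ {k}) :
    ¬ (G.induce ({k}ᶜ : Set V)).Preconnected := by
  intro h
  have hne : (⟨j, hjk⟩ : ({k}ᶜ : Set V)) ≠ ⟨l, hlk⟩ := fun e => hlj (congrArg Subtype.val e).symm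
  obtain ⟨p⟩ := h ⟨j, hjk⟩ ⟨l, hlk⟩
  cases p with
  | nil => exact hne rfl
  | @cons _ v _ hadj _ => exact v.2 (hN hadj)

theorem mainTheorem3 {n : ℕ} (hn : 3 ≤ n) (G : SimpleGraph (Fin n)) [DecidableRel G.Adj]
    {D : Type uD} [Nontrivial D] (P : KeyProtocol.{uD, uM, uT} n G D) (hP : P.Transmits) :
    (P.SenderAnonymous → ∀ j : Fin n, 2 ≤ G.degree j) ∧
    (∀ j k : Fin n, j ≠ k → G.neighborSet j ⊆ {k} →
      ¬ (G.induce ({k}ᶜ : Set (Fin n))).Preconnected ∧ P.BreaksAnonymityOf {k} j) := by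
  refine ⟨fun hA j => ?_, fun j k hjk hN => ⟨?_, ?_⟩⟩
  · by_contra! hdeg
    obtain ⟨k, hjk, hN⟩ : ∃ k, j ≠ k ∧ G.neighborSet j ⊆ {k} := by
      -- If `j` is isolated, any other player serves as `k`; otherwise `k` is its unique neighbour.
      rcases (G.neighborSet j).eq_empty_or_nonempty with h0 | ⟨k, hk⟩
      · have : Nontrivial (Fin n) := Fin.nontrivial_iff_two_le.2 (by lia)
        obtain ⟨k, hk⟩ := exists_ne j
        exact ⟨k, hk.symm, by simp [h0]⟩
      · refine ⟨k, G.ne_of_adj hk, fun l hl => ?_⟩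
        exact Finset.card_le_one.1 (Nat.lt_succ_iff.1 hdeg) l (by simpa using hl) k
          (by simpa using hk)
    have hcard : ({k} : Finset (Fin n)).card + 2 ≤ n := by rw [Finset.card_singleton]; lia
    exact P.not_breaksAnonymityOf_of_anonymousAgainst (hA {k} hcard) j
      (P.breaksAnonymityOf_of_neighborSet_subset hn hP hjk hN)
  · obtain ⟨l, hl⟩ := Finset.exists_mem_notMem_of_card_lt_card (s := {j, k})
      (t := (Finset.univ : Finset (Fin n)))
      (lt_of_le_of_lt Finset.card_le_two (by rw [Finset.card_univ, Fintype.card_fin]; lia))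
    simp only [Finset.mem_univ, Finset.mem_insert, Finset.mem_singleton, true_and, not_or] at hl
    exact SimpleGraph.not_preconnected_induce_compl_singleton hjk hl.2 hl.1 hN
  · exact P.breaksAnonymityOf_of_neighborSet_subset hn hP hjk hN
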